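/- For $n\ge 3$ let $L_n(a,b,-,d)$ be the language over the alphabet $\{a,b,d\}$ accepted by the deterministic finite automaton with state set $\{1,\dots,n\}$, initial state $1$, unique final state $n$, in which $a$ induces the cycle $(1,2,\dots,n-1)$, $b$ induces the cycle $(2,3,\dots,n-1)$ (the identity if $n=3$), and $d$ sends $n-1$ to $n$; every letter fixes all states not mentioned. (Equivalently, it is the language obtained by deleting the letter $c$, that is, by removing all words containing $c$ and restricting the alphabet to $\{a,b,d\}$, from the language $L_n(a,b,c,d)$ of the automaton that has the additional letter $c$, which sends $n-1$ to $1$ and fixes all other states.) The complexity of a language $L$ over an alphabet $\Sigma$ is the number of distinct left quotients $w^{-1}L=\{x\in\Sigma^*\mid wx\in L\}$, $w\in\Sigma^*$; for a regular language this is the number of states of a minimal complete deterministic automaton over $\Sigma$ accepting $L$. Suppose $m,n\ge 3$ and $m\ne n$. Then, as languages over $\{a,b,d\}$: 1. the complexity of $L_m(a,b,-,d)\cap L_n(a,b,-,d)$ is $mn$; 2. the complexity of the symmetric difference $L_m(a,b,-,d)\oplus L_n(a,b,-,d)$ is $mn$; 3. the complexity of $L_m(a,b,-,d)\setminus L_n(a,b,-,d)$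 is $mn-(m-1)$; 4. the complexity of $L_m(a,b,-,d)\cup L_n(a,b,-,d)$ is $mn-(m+n-2)$. -/

import Mathlib

namespace RightIdeal

/-- The (quotient/state) complexity `κ(L)` of a language `L`: the number of distinct left quotients
`w⁻¹L = {x | wx ∈ L}`, where `w` ranges over all words over the alphabet of `L`
(`⊤` if there are infinitely many). -/
noncomputable def complexity {α : Type*} (L : Language α) : ℕ∞ :=
  (Set.range L.leftQuotient).encard

/-- The alphabet `π(Σ)` of a permutational dialect: the letters that are values of the partial
permutation `π` of `Σ`. -/
abbrev DialectAlphabet {α : Type*} (π : α ≃. α) : Type _ :=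
  {y : α // ∃ x : α, π x = some y}

/-- The permutational dialect `s_π(L)`, a language over the alphabet `π(Σ)`: it consists of the words
`π(x₁)⋯π(x_k)` for those words `x₁⋯x_k ∈ L` for which all of `π(x₁), …, π(x_k)` are defined. -/
def dialect {α : Type*} (π : α ≃. α) (L : Language α) : Language (DialectAlphabet π) :=
  {w | ∃ u ∈ L, u.map π = w.map (fun y => some y.1)}

/-- The ordered alphabet `Σ = {a, b, c, d}`. -/
inductive Letter : Type
  | a | b | c | d
  deriving DecidableEq

/-- The map of `ℕ` that acts as the cycle `(i, i+1, …, j)` on `{i, …, j}` and fixes all other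
numbers (it is the identity if `i = j`). -/
def cycle (i j q : ℕ) : ℕ :=
  if i ≤ q ∧ q < j then q + 1 else if q = j then i else q

/-- The map of `ℕ` that sends `i` to `j` and fixes all other numbers, written `(i → j)`. -/
def moveTo (i j q : ℕ) : ℕ :=
  if q = i then j else q

/-- The transformations induced by the letters:
`a : (1, …, n-1)`, `b : (2, …, n-1)`, `c : (n-1 → 1)`, `d : (n-1 → n)`. -/
def transformation (n : ℕ) : Letter → ℕ → ℕ
  | .a => cycle 1 (n - 1)
  | .b => cycle 2 (n - 1)
  | .c => moveTo (n - 1) 1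
  | .d => moveTo (n - 1) n

/-- The state set `Q_n = {1, …, n}`. -/
abbrev State (n : ℕ) : Type := {q : ℕ // 1 ≤ q ∧ q ≤ n}

theorem transformation_mem {n : ℕ} (hn : 3 ≤ n) (x : Letter) (q : State n) :
    1 ≤ transformation n x q.1 ∧ transformation n x q.1 ≤ n := by
  obtain ⟨q, h1, h2⟩ := q
  cases x <;> simp only [transformation, cycle, moveTo] <;> split_ifs <;> omega

/-- The DFA `D_n(a,b,c,d) = (Q_n, Σ, δ_n, 1, {n})`, for `n ≥ 3`. -/
def witnessDFA (n : ℕ) (hn : 3 ≤ n) : DFA Letter (State n) where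
  step q x := ⟨transformation n x q.1, transformation_mem hn x q⟩
  start := ⟨1, by omega⟩
  accept := {q | q.1 = n}

/-- The language `L_n(a,b,c,d)` accepted by `D_n(a,b,c,d)`. -/
def witnessLanguage (n : ℕ) (hn : 3 ≤ n) : Language Letter :=
  (witnessDFA n hn).accepts

/-- The partial permutation `a ↦ a`, `b ↦ b`, `d ↦ d`, undefined at `c`; in list form `(a, b, -, d)`. -/
def eraseC : Letter ≃. Letter where
  toFun
    | .c => none
    | x => some x
  invFun
    | .c => none
    | x => some x
  inv x y := by cases x <;> cases y <;> simp

/-- The language `L_n(a,b,-,d)` over the alphabet `{a, b, d}`. -/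
def witnessABD (n : ℕ) (hn : 3 ≤ n) : Language (DialectAlphabet eraseC) :=
  dialect eraseC (witnessLanguage n hn)

end RightIdeal

namespace RightIdeal

/-! All four languages are accepted by the product automaton on pairs of states started at `(1, 1)`,
with acceptance given by a predicate `P`. Quotients are therefore the languages `pairLanguage` of
reachable pairs, to be counted up to equality. Since `m ≠ n`, the cycles of `a` get out of phase and
every pair is reachable (`reaches_all`). For separation, letters merge states only into the final
one, and any non-final pair can return to `(1, 1)`; the word `(db)^r` then makes all other states
final (`exists_isolating`). For intersection and symmetric difference no two pairs are equivalent.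
For the difference, the `m` pairs with second component `n` accept nothing and become one class; for
the union, the `m + n - 1` pairs with a final component accept everything and become one class. -/

/-- The alphabet `{a, b, d}`. -/
abbrev ABD : Type := DialectAlphabet eraseC

/-- The letter `a` of `{a, b, d}`. -/
def letterA : ABD := ⟨.a, .a, rfl⟩

/-- The letter `b` of `{a, b, d}`. -/
def letterB : ABD := ⟨.b, .b, rfl⟩

/-- The letter `d` of `{a, b, d}`. -/
def letterD : ABD := ⟨.d, .d, rfl⟩

theorem abd_cases (x : ABD) : x = letterA ∨ x = letterB ∨ x = letterD := by
  obtain ⟨x, y, h⟩ := x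
  have h' : eraseC.toFun y = some x := h
  cases y <;> simp only [eraseC, Option.some.injEq, reduceCtorEq] at h' <;> subst h' <;>
    simp [letterA, letterB, letterD]

theorem eraseC_eq_some {x y : Letter} (h : eraseC x = some y) : x = y := by
  have h' : eraseC.toFun x = some y := h
  cases x <;> simp_all [eraseC]

theorem eraseC_val (x : ABD) : eraseC x.1 = some x.1 := by
  obtain rfl | rfl | rfl := abd_cases x <;> rfl

/-- The state reached from `q` in the automaton with `n` states on reading `w`. -/
def run (n : ℕ) (w : List ABD) (q : ℕ) : ℕ :=
  w.foldl (fun q x => transformation n x.1 q) q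

@[simp] theorem run_nil (n q : ℕ) : run n [] q = q := rfl

theorem run_cons (n : ℕ) (x : ABD) (w : List ABD) (q : ℕ) :
    run n (x :: w) q = run n w (transformation n x.1 q) := rfl

theorem run_append (n : ℕ) (v w : List ABD) (q : ℕ) :
    run n (v ++ w) q = run n w (run n v q) := by
  simp [run]

/-- As `eraseC` is a partial identity, the only possible preimage of a word is the word itself. -/
theorem mem_witnessABD {n : ℕ} (hn : 3 ≤ n) (w : List ABD) :
    w ∈ witnessABD n hn ↔ run n w 1 = n := by
  have h1 : w ∈ witnessABD n hn ↔ w.map Subtype.val ∈ witnessLanguage n hn := by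
    constructor
    · rintro ⟨u, hu, h⟩
      have : u = w.map Subtype.val := by
        clear hu
        induction u generalizing w with
        | nil => cases w <;> simp_all
        | cons x u ih =>
          cases w with
          | nil => simp at h
          | cons y w =>
            simp only [List.map_cons, List.cons.injEq] at h ⊢
            exact ⟨eraseC_eq_some h.1, ih w h.2⟩
      exact this ▸ hu
    · intro h
      refine ⟨_, h, ?_⟩
      simp only [List.map_map]
      exact List.map_congr_left fun x _ => eraseC_val x
  have h2 : ∀ (v : List ABD) (q : State n),
      ((witnessDFA n hn).evalFrom q (v.map Subtype.val)).1 = run n v q.1 := by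
    intro v
    induction v with
    | nil => intro q; rfl
    | cons x v ih =>
      intro q
      exact ih ((witnessDFA n hn).step q x.1)
  rw [h1, ← h2 w ⟨1, by omega⟩]
  rfl

/-! ### Action of words on a single automaton -/

section Run

variable {n : ℕ}

theorem step_mem (hn : 3 ≤ n) (x : ABD) {q : ℕ} (hq : q ∈ Finset.Icc 1 n) :
    transformation n x.1 q ∈ Finset.Icc 1 n :=
  Finset.mem_Icc.2 (transformation_mem hn x.1 ⟨q, Finset.mem_Icc.1 hq⟩)

theorem run_mem (hn : 3 ≤ n) (w : List ABD) {q : ℕ} (hq : q ∈ Finset.Icc 1 n) :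
    run n w q ∈ Finset.Icc 1 n := by
  induction w generalizing q with
  | nil => exact hq
  | cons x w ih => exact ih (step_mem hn x hq)

theorem run_final (hn : 3 ≤ n) (w : List ABD) : run n w n = n := by
  induction w with
  | nil => rfl
  | cons x w ih =>
    have : transformation n x.1 n = n := by
      obtain rfl | rfl | rfl := abd_cases x <;>
        simp only [transformation, cycle, moveTo, letterA, letterB, letterD] <;>
        split_ifs <;> omega
    rw [run_cons, this, ih]

/-- The letters `a` and `b` permute the states, and `d` only identifies `n - 1` with `n`. -/
theorem step_inj (hn : 3 ≤ n) (x : ABD) {p q : ℕ} (hp : p ∈ Finset.Icc 1 n)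
    (hq : q ∈ Finset.Icc 1 n) (h : transformation n x.1 p = transformation n x.1 q)
    (hf : transformation n x.1 p ≠ n) : p = q := by
  rw [Finset.mem_Icc] at hp hq
  obtain rfl | rfl | rfl := abd_cases x <;>
    simp only [transformation, cycle, moveTo, letterA, letterB, letterD] at h hf <;>
    split_ifs at h hf <;> omega

/-- Distinct states can only be merged into the final state. -/
theorem run_inj (hn : 3 ≤ n) (w : List ABD) {p q : ℕ} (hp : p ∈ Finset.Icc 1 n)
    (hq : q ∈ Finset.Icc 1 n) (h : run n w p = run n w q) (hf : run n w p ≠ n) : p = q := by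
  induction w generalizing p q with
  | nil => exact h
  | cons x w ih =>
    have hs := ih (step_mem hn x hp) (step_mem hn x hq) h hf
    refine step_inj hn x hp hq hs fun hx => hf ?_
    rw [run_cons, hx, run_final hn]

theorem step_a_lt {q : ℕ} (h1 : 1 ≤ q) (h : q < n - 1) :
    transformation n letterA.1 q = q + 1 := by
  simp only [transformation, cycle, letterA]; split_ifs <;> omega

theorem step_a_wrap : transformation n letterA.1 (n - 1) = 1 := by
  simp only [transformation, cycle, letterA]; split_ifs <;> omega

theorem step_b_one (hn : 3 ≤ n) : transformation n letterB.1 1 = 1 := by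
  simp only [transformation, cycle, letterB]; split_ifs <;> omega

theorem step_b_lt {q : ℕ} (h1 : 2 ≤ q) (h : q < n - 1) :
    transformation n letterB.1 q = q + 1 := by
  simp only [transformation, cycle, letterB]; split_ifs <;> omega

theorem step_b_wrap : transformation n letterB.1 (n - 1) = 2 := by
  simp only [transformation, cycle, letterB]; split_ifs <;> omega

theorem step_d_ne {q : ℕ} (h : q ≠ n - 1) : transformation n letterD.1 q = q := by
  simp [transformation, moveTo, letterD, h]

theorem step_d_eq : transformation n letterD.1 (n - 1) = n := by
  simp [transformation, moveTo, letterD]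

/-- The word `(db)^r`, which for large `r` sends all states but `1` to the final state. -/
def collapse : ℕ → List ABD
  | 0 => []
  | r + 1 => letterD :: letterB :: collapse r

theorem run_collapse_one (hn : 3 ≤ n) (r : ℕ) : run n (collapse r) 1 = 1 := by
  induction r with
  | zero => rfl
  | succ r ih => rw [collapse, run_cons, run_cons, step_d_ne (by omega), step_b_one hn, ih]

/-- Each round `db` advances `q` by one until `d` absorbs `n - 1`, so `n - q` rounds suffice. -/
theorem run_collapse (hn : 3 ≤ n) (r : ℕ) {q : ℕ} (h2 : 2 ≤ q) (hq : q ≤ n) (hr : n ≤ q + r) :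
    run n (collapse r) q = n := by
  induction r generalizing q with
  | zero => simp only [collapse, run_nil]; omega
  | succ r ih =>
    rcases lt_trichotomy q (n - 1) with h | rfl | h
    · rw [collapse, run_cons, run_cons, step_d_ne (by omega), step_b_lt h2 h]
      exact ih (by omega) (by omega) (by omega)
    · rw [collapse, run_cons, step_d_eq, run_final hn]
    · obtain rfl : q = n := by omega
      exact run_final hn _

end Run

/-! ### Reachability in the product automaton -/

/-- Some word takes the pair of states `p` to the pair of states `q`. -/
def Reaches (m n : ℕ) (p q : ℕ × ℕ) : Prop :=
  ∃ w : List ABD, run m w p.1 = q.1 ∧ run n w p.2 = q.2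

section Reach

variable {m n : ℕ}

theorem Reaches.refl (p : ℕ × ℕ) : Reaches m n p p := ⟨[], rfl, rfl⟩

theorem Reaches.trans {p q r : ℕ × ℕ} (h : Reaches m n p q) (h' : Reaches m n q r) :
    Reaches m n p r := by
  obtain ⟨v, h1, h2⟩ := h
  obtain ⟨w, h3, h4⟩ := h'
  exact ⟨v ++ w, by rw [run_append, h1, h3], by rw [run_append, h2, h4]⟩

theorem Reaches.swap {i j i' j' : ℕ} (h : Reaches m n (i, j) (i', j')) :
    Reaches n m (j, i) (j', i') :=
  let ⟨w, h1, h2⟩ := h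
  ⟨w, h2, h1⟩

theorem reaches_step (x : ABD) {i j i' j' : ℕ} (h1 : transformation m x.1 i = i')
    (h2 : transformation n x.1 j = j') : Reaches m n (i, j) (i', j') :=
  ⟨[x], h1, h2⟩

theorem reaches_diagonal {i j : ℕ} (hi : 1 ≤ i) (hj : 1 ≤ j) (r : ℕ) (hi' : i + r < m)
    (hj' : j + r < n) : Reaches m n (i, j) (i + r, j + r) := by
  induction r with
  | zero => exact .refl _
  | succ r ih =>
    exact (ih (by omega) (by omega)).trans
      (reaches_step letterA (step_a_lt (by omega) (by omega)) (step_a_lt (by omega) (by omega)))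

theorem reaches_one_add (hm : 3 ≤ m) {j : ℕ} (hj : 2 ≤ j) (r : ℕ) (hj' : j + r < n) :
    Reaches m n (1, j) (1, j + r) := by
  induction r with
  | zero => exact .refl _
  | succ r ih =>
    exact (ih (by omega)).trans
      (reaches_step letterB (step_b_one hm) (step_b_lt (by omega) (by omega)))

theorem reaches_one_two (hm : 3 ≤ m) {j j' : ℕ} (hj : 2 ≤ j) (hjn : j < n) (hj' : 2 ≤ j')
    (hjn' : j' < n) : Reaches m n (1, j) (1, j') := by
  have h1 := reaches_one_add (n := n) hm hj (n - 1 - j) (by omega)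
  rw [show j + (n - 1 - j) = n - 1 by omega] at h1
  have h2 : Reaches m n (1, n - 1) (1, 2) := reaches_step letterB (step_b_one hm) step_b_wrap
  have h3 := reaches_one_add (m := m) (n := n) hm le_rfl (j' - 2) (by omega)
  rw [show 2 + (j' - 2) = j' by omega] at h3
  exact (h1.trans h2).trans h3

theorem reaches_of_one_one_of_lt (hm : 3 ≤ m) (hmn : m < n) {i j : ℕ} (hi : 1 ≤ i) (him : i < m)
    (hj : 1 ≤ j) (hjn : j < n) : Reaches m n (1, 1) (i, j) := by
  have row : ∀ j, 1 ≤ j → j < n → Reaches m n (1, 1) (1, j) := by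
    intro j hj hjn
    obtain rfl | hj := hj.eq_or_lt
    · exact .refl _
    have h1 := reaches_diagonal (m := m) (n := n) le_rfl le_rfl (m - 2) (by omega) (by omega)
    rw [show 1 + (m - 2) = m - 1 by omega] at h1
    -- Here `m < n` breaks the symmetry: `a` wraps only the first component, and then `b` rotates
    -- the second alone.
    have h2 : Reaches m n (m - 1, m - 1) (1, m - 1 + 1) :=
      reaches_step letterA step_a_wrap (step_a_lt (by omega) (by omega))
    exact (h1.trans h2).trans (reaches_one_two hm (by omega) (by omega) hj hjn)
  have col : ∀ i, 1 ≤ i → i < m → Reaches m n (1, 1) (i, 1) := by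
    intro i hi him
    obtain rfl | hi := hi.eq_or_lt
    · exact .refl _
    have h2 : Reaches m n (1, n - 1) (1 + 1, 1) :=
      reaches_step letterA (step_a_lt (by omega) (by omega)) step_a_wrap
    exact ((row (n - 1) (by omega) (by omega)).trans h2).trans
      (reaches_one_two (by omega) (by omega) (by omega) hi him).swap
  -- Every pair lies on a diagonal, followed by powers of `a`, that starts in the first row or
  -- column.
  rcases le_total i j with h | h
  · have := reaches_diagonal (m := m) (n := n) (i := 1) (j := j - i + 1) le_rfl (by omega) (i - 1)
      (by omega) (by omega)
    rw [show 1 + (i - 1) = i by omega, show j - i + 1 + (i - 1) = j by omega] at this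
    exact (row _ (by omega) (by omega)).trans this
  · have := reaches_diagonal (m := m) (n := n) (i := i - j + 1) (j := 1) (by omega) le_rfl (j - 1)
      (by omega) (by omega)
    rw [show 1 + (j - 1) = j by omega, show i - j + 1 + (j - 1) = i by omega] at this
    exact (col _ (by omega) (by omega)).trans this

theorem step_a_mem (hn : 3 ≤ n) {q : ℕ} (h1 : 1 ≤ q) (h : q < n) :
    1 ≤ transformation n letterA.1 q ∧ transformation n letterA.1 q < n := by
  simp only [transformation, cycle, letterA]; split_ifs <;> omega

theorem exists_reaches_one (hn : 3 ≤ n) (r : ℕ) {i j : ℕ} (hi : 1 ≤ i)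
    (hr : i + r = m - 1) (hj : 1 ≤ j) (hjn : j < n) :
    ∃ j', 1 ≤ j' ∧ j' < n ∧ Reaches m n (i, j) (1, j') := by
  induction r generalizing i j with
  | zero =>
    obtain rfl : i = m - 1 := hr
    obtain ⟨h1, h2⟩ := step_a_mem hn hj hjn
    exact ⟨_, h1, h2, reaches_step letterA step_a_wrap rfl⟩
  | succ r ih =>
    obtain ⟨h1, h2⟩ := step_a_mem hn hj hjn
    obtain ⟨j', h3, h4, h5⟩ := ih (i := i + 1) (by omega) (by omega) h1 h2
    exact ⟨j', h3, h4, .trans (reaches_step letterA (step_a_lt hi (by omega)) rfl) h5⟩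

theorem reaches_one_one_of_lt (hm : 3 ≤ m) (hmn : m < n) {i j : ℕ} (hi : 1 ≤ i) (him : i < m)
    (hj : 1 ≤ j) (hjn : j < n) : Reaches m n (i, j) (1, 1) := by
  obtain ⟨j', h1, h2, h3⟩ :=
    exists_reaches_one (m := m) (n := n) (by omega) (m - 1 - i) hi (by omega) hj hjn
  refine h3.trans ?_
  obtain rfl | h1 := h1.eq_or_lt
  · exact .refl _
  -- The offset `n - m` makes both cycles wrap at the same `a`.
  have h4 := reaches_diagonal (m := m) (n := n) (i := 1) (j := n - m + 1) le_rfl (by omega) (m - 2)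
    (by omega) (by omega)
  rw [show 1 + (m - 2) = m - 1 by omega, show n - m + 1 + (m - 2) = n - 1 by omega] at h4
  have h5 : Reaches m n (m - 1, n - 1) (1, 1) :=
    reaches_step letterA step_a_wrap step_a_wrap
  exact ((reaches_one_two hm h1 h2 (by omega) (by omega)).trans h4).trans h5

theorem reaches_of_one_one (hm : 3 ≤ m) (hn : 3 ≤ n) (hmn : m ≠ n) {i j : ℕ} (hi : 1 ≤ i)
    (him : i < m) (hj : 1 ≤ j) (hjn : j < n) : Reaches m n (1, 1) (i, j) := by
  rcases hmn.lt_or_gt with h | h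
  · exact reaches_of_one_one_of_lt hm h hi him hj hjn
  · exact (reaches_of_one_one_of_lt hn h hj hjn hi him).swap

theorem reaches_one_one (hm : 3 ≤ m) (hn : 3 ≤ n) (hmn : m ≠ n) {i j : ℕ} (hi : 1 ≤ i)
    (him : i < m) (hj : 1 ≤ j) (hjn : j < n) : Reaches m n (i, j) (1, 1) := by
  rcases hmn.lt_or_gt with h | h
  · exact reaches_one_one_of_lt hm h hi him hj hjn
  · exact (reaches_one_one_of_lt hn h hj hjn hi him).swap

theorem reaches_final_left (hm : 3 ≤ m) (hn : 3 ≤ n) (hmn : m ≠ n) {j : ℕ} (hj : 1 ≤ j)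
    (hjn : j < n) : Reaches m n (1, 1) (m, j) := by
  have h1 := reaches_of_one_one hm hn hmn (i := m - 1) (j := 1) (by omega) (by omega) le_rfl
    (by omega)
  have h2 : Reaches m n (m - 1, 1) (m, 1) :=
    reaches_step letterD step_d_eq (step_d_ne (by omega))
  refine (h1.trans h2).trans ?_
  -- State `m` is absorbing, so only the effect on the second component matters.
  obtain ⟨w, -, hw⟩ := reaches_of_one_one hm hn hmn (i := 1) (j := j) le_rfl (by omega) hj hjn
  exact ⟨w, run_final hm w, hw⟩

/-- All pairs of states are reachable from the pair of initial states. -/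
theorem reaches_all (hm : 3 ≤ m) (hn : 3 ≤ n) (hmn : m ≠ n) {i j : ℕ} (hi : i ∈ Finset.Icc 1 m)
    (hj : j ∈ Finset.Icc 1 n) : Reaches m n (1, 1) (i, j) := by
  rw [Finset.mem_Icc] at hi hj
  rcases hi.2.eq_or_lt with rfl | hi' <;> rcases hj.2.eq_or_lt with rfl | hj'
  · exact (reaches_of_one_one hm hn hmn (i := i - 1) (j := j - 1) (by omega) (by omega) (by omega)
      (by omega)).trans (reaches_step letterD step_d_eq step_d_eq)
  · exact reaches_final_left hm hn hmn hj.1 hj'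
  · exact (reaches_final_left hn hm hmn.symm hi.1 hi').swap
  · exact reaches_of_one_one hm hn hmn hi.1 hi' hj.1 hj'

/-! ### Separating words -/

/-- A word can send a given pair of non-final states to `(1, 1)` and all the other states of both
automata to the final states. -/
theorem exists_isolating (hm : 3 ≤ m) (hn : 3 ≤ n) (hmn : m ≠ n) {i j : ℕ} (hi : 1 ≤ i)
    (him : i < m) (hj : 1 ≤ j) (hjn : j < n) :
    ∃ w, run m w i = 1 ∧ run n w j = 1 ∧ (∀ p ∈ Finset.Icc 1 m, p ≠ i → run m w p = m) ∧
      ∀ q ∈ Finset.Icc 1 n, q ≠ j → run n w q = n := by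
  have key : ∀ {k : ℕ}, 3 ≤ k → k ≤ m + n → ∀ {v : List ABD} {i : ℕ}, i ∈ Finset.Icc 1 k →
      run k v i = 1 → ∀ p ∈ Finset.Icc 1 k, p ≠ i → run k (v ++ collapse (m + n)) p = k := by
    intro k hk hkr v i hi hv p hp hpi
    have h1 : run k v p ≠ 1 := fun h => hpi
      (run_inj hk v hp hi (h.trans hv.symm) (by omega))
    have h2 := Finset.mem_Icc.1 (run_mem hk v hp)
    rw [run_append]
    exact run_collapse hk _ (by omega) h2.2 (by omega)
  obtain ⟨v, h1, h2⟩ := reaches_one_one hm hn hmn hi him hj hjn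
  refine ⟨v ++ collapse (m + n), ?_, ?_, key hm (by omega) (Finset.mem_Icc.2 ⟨hi, him.le⟩) h1,
    key hn (by omega) (Finset.mem_Icc.2 ⟨hj, hjn.le⟩) h2⟩
  · rw [run_append, h1, run_collapse_one hm]
  · rw [run_append, h2, run_collapse_one hn]

/-- A word can send all states of both automata, except for one given non-final state of the first
one, to the final states. -/
theorem exists_separating (hm : 3 ≤ m) (hn : 3 ≤ n) (hmn : m ≠ n) {i : ℕ} (hi : 1 ≤ i)
    (him : i < m) :
    ∃ w, run m w i ≠ m ∧ (∀ p ∈ Finset.Icc 1 m, p ≠ i → run m w p = m) ∧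
      ∀ q ∈ Finset.Icc 1 n, run n w q = n := by
  -- Isolate `(i, 1)`, then finish off the second automaton by a word from `(1, 1)` to `(1, n)`.
  obtain ⟨v, h1, h2, h3, h4⟩ := exists_isolating hm hn hmn hi him le_rfl (show 1 < n by omega)
  have hr : Reaches m n (1, 1) (1, n) :=
    reaches_all hm hn hmn (by simp; omega) (by simp; omega)
  obtain ⟨w, h5, h6⟩ := hr
  refine ⟨v ++ w, ?_, fun p hp hpi => ?_, fun q hq => ?_⟩
  · rw [run_append, h1, h5]; dsimp only; omega
  · rw [run_append, h3 p hp hpi, run_final hm]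
  · rw [run_append]
    by_cases h : q = 1
    · rw [h, h2, h6]
    · rw [h4 q hq h, run_final hn]

end Reach

/-! ### Counting inequivalent pairs -/

/-- The words taking the pair of states `p` to a pair of states satisfying `P`. -/
def pairLanguage (m n : ℕ) (P : ℕ → ℕ → Prop) (p : ℕ × ℕ) : Language ABD :=
  {x | P (run m x p.1) (run n x p.2)}

section Complexity

variable {m n : ℕ} {P : ℕ → ℕ → Prop}

theorem mem_pairLanguage {p : ℕ × ℕ} {x : List ABD} :
    x ∈ pairLanguage m n P p ↔ P (run m x p.1) (run n x p.2) := Iff.rfl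

theorem range_leftQuotient (hm : 3 ≤ m) (hn : 3 ≤ n) (hmn : m ≠ n) :
    Set.range (pairLanguage m n P (1, 1)).leftQuotient =
      pairLanguage m n P '' (Finset.Icc 1 m ×ˢ Finset.Icc 1 n : Finset (ℕ × ℕ)) := by
  have hq : ∀ w, (pairLanguage m n P (1, 1)).leftQuotient w =
      pairLanguage m n P (run m w 1, run n w 1) := by
    intro w
    ext x
    rw [Language.mem_leftQuotient, mem_pairLanguage, mem_pairLanguage, run_append, run_append]
  ext K
  constructor
  · rintro ⟨w, rfl⟩
    refine ⟨(run m w 1, run n w 1), ?_, (hq w).symm⟩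
    rw [Finset.mem_coe, Finset.mem_product]
    exact ⟨run_mem hm w (by simp; omega), run_mem hn w (by simp; omega)⟩
  · rintro ⟨⟨i, j⟩, h, rfl⟩
    rw [Finset.mem_coe, Finset.mem_product] at h
    obtain ⟨w, h1, h2⟩ := reaches_all hm hn hmn h.1 h.2
    refine ⟨w, ?_⟩
    rw [hq, h1, h2]

/-- The complexity is the number of elements of a set `T` of representatives of the pairs of states
up to equivalence. -/
theorem complexity_pairLanguage (hm : 3 ≤ m) (hn : 3 ≤ n) (hmn : m ≠ n) (T : Finset (ℕ × ℕ))
    (hT : T ⊆ Finset.Icc 1 m ×ˢ Finset.Icc 1 n)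
    (hrep : ∀ p ∈ Finset.Icc 1 m ×ˢ Finset.Icc 1 n,
      ∃ q ∈ T, pairLanguage m n P p = pairLanguage m n P q)
    (hsep : Set.InjOn (pairLanguage m n P) T) :
    complexity (pairLanguage m n P (1, 1)) = (T.card : ℕ∞) := by
  have him : pairLanguage m n P '' (Finset.Icc 1 m ×ˢ Finset.Icc 1 n : Finset (ℕ × ℕ)) =
      pairLanguage m n P '' T := by
    refine Set.Subset.antisymm ?_ (Set.image_mono (by exact_mod_cast hT))
    rintro _ ⟨p, hp, rfl⟩
    obtain ⟨q, hq, h⟩ := hrep p hp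
    exact ⟨q, hq, h.symm⟩
  rw [complexity, range_leftQuotient hm hn hmn, him, hsep.encard_image,
    Set.encard_coe_eq_coe_finsetCard]

theorem run_iff {p q : ℕ × ℕ} (h : pairLanguage m n P p = pairLanguage m n P q) (w : List ABD) :
    P (run m w p.1) (run n w p.2) ↔ P (run m w q.1) (run n w q.2) :=
  iff_of_eq (congrArg (fun L : Language ABD => w ∈ L) h)

/-- If `P` tells `(m, n)` from `(i, n)` for `i < m`, equivalent pairs have equal first components. -/
theorem fst_eq (hm : 3 ≤ m) (hn : 3 ≤ n) (hmn : m ≠ n)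
    (hP : ∀ i ≠ m, ¬(P i n ↔ P m n)) {p q : ℕ × ℕ}
    (hp : p ∈ Finset.Icc 1 m ×ˢ Finset.Icc 1 n) (hq : q ∈ Finset.Icc 1 m ×ˢ Finset.Icc 1 n)
    (h : pairLanguage m n P p = pairLanguage m n P q) : p.1 = q.1 := by
  by_contra hne
  wlog hlt : p.1 < m generalizing p q
  · have hp' := Finset.mem_Icc.1 (Finset.mem_product.1 hp).1
    have hq' := Finset.mem_Icc.1 (Finset.mem_product.1 hq).1
    exact this hq hp h.symm (Ne.symm hne) (by omega)
  rw [Finset.mem_product] at hp hq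
  obtain ⟨w, h1, h2, h3⟩ := exists_separating hm hn hmn (Finset.mem_Icc.1 hp.1).1 hlt
  have := run_iff h w
  rw [h3 _ hp.2, h3 _ hq.2, h2 _ hq.1 (Ne.symm hne)] at this
  exact hP _ h1 this

/-- The mirror image of `fst_eq`, by exchanging the two automata and the arguments of `P`. -/
theorem snd_eq (hm : 3 ≤ m) (hn : 3 ≤ n) (hmn : m ≠ n)
    (hP : ∀ j ≠ n, ¬(P m j ↔ P m n)) {p q : ℕ × ℕ}
    (hp : p ∈ Finset.Icc 1 m ×ˢ Finset.Icc 1 n) (hq : q ∈ Finset.Icc 1 m ×ˢ Finset.Icc 1 n)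
    (h : pairLanguage m n P p = pairLanguage m n P q) : p.2 = q.2 := by
  rw [Finset.mem_product] at hp hq
  exact fst_eq (P := fun j i => P i j) (p := p.swap) (q := q.swap) hn hm hmn.symm hP
    (Finset.mem_product.2 hp.symm) (Finset.mem_product.2 hq.symm) h

/-- If `P` separates `(m, n)` from the pairs with exactly one final component, all pairs of
states are inequivalent. -/
theorem complexity_eq_mul (hm : 3 ≤ m) (hn : 3 ≤ n) (hmn : m ≠ n)
    (h1 : ∀ i ≠ m, ¬(P i n ↔ P m n)) (h2 : ∀ j ≠ n, ¬(P m j ↔ P m n)) :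
    complexity (pairLanguage m n P (1, 1)) = ((m * n : ℕ) : ℕ∞) := by
  rw [complexity_pairLanguage hm hn hmn (Finset.Icc 1 m ×ˢ Finset.Icc 1 n) subset_rfl
    (fun p hp => ⟨p, hp, rfl⟩)
    (fun p hp q hq h => Prod.ext (fst_eq hm hn hmn h1 hp hq h) (snd_eq hm hn hmn h2 hp hq h))]
  simp

/-- The pair `(1, n)` represents the class with empty language. `fst_eq` does not apply, because `P
i n` is always false. -/
theorem complexity_sdiff (hm : 3 ≤ m) (hn : 3 ≤ n) (hmn : m ≠ n) :
    complexity (pairLanguage m n (fun i j => i = m ∧ j ≠ n) (1, 1)) =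
      ((m * n - (m - 1) : ℕ) : ℕ∞) := by
  have hnot : (1, n) ∉ Finset.Icc 1 m ×ˢ Finset.Icc 1 (n - 1) := by
    simp only [Finset.mem_product, Finset.mem_Icc]; omega
  have hsub : insert (1, n) (Finset.Icc 1 m ×ˢ Finset.Icc 1 (n - 1)) ⊆
      Finset.Icc 1 m ×ˢ Finset.Icc 1 n := by
    intro ⟨i, j⟩ h
    simp only [Finset.mem_insert, Finset.mem_product, Finset.mem_Icc, Prod.mk.injEq] at h ⊢
    omega
  rw [complexity_pairLanguage hm hn hmn (insert (1, n) (Finset.Icc 1 m ×ˢ Finset.Icc 1 (n - 1)))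
    hsub]
  · rw [Finset.card_insert_of_notMem hnot, Finset.card_product, Nat.card_Icc, Nat.card_Icc]
    congr 1
    obtain ⟨n, rfl⟩ : ∃ k, n = k + 1 := ⟨n - 1, by omega⟩
    simp only [Nat.add_sub_cancel, Nat.mul_succ]
    omega
  · rintro ⟨i, j⟩ hp
    simp only [Finset.mem_product, Finset.mem_Icc] at hp
    rcases hp.2.2.eq_or_lt with rfl | hj
    · refine ⟨(1, j), Finset.mem_insert_self _ _, ?_⟩
      ext x
      simp [mem_pairLanguage, run_final hn]
    · refine ⟨(i, j), Finset.mem_insert_of_mem ?_, rfl⟩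
      simp only [Finset.mem_product, Finset.mem_Icc]
      omega
  · rintro ⟨i, j⟩ hp ⟨i', j'⟩ hq h
    have hj : j = j' := snd_eq hm hn hmn (fun j hj => by simp [hj]) (hsub hp) (hsub hq) h
    subst hj
    simp only [Finset.coe_insert, Set.mem_insert_iff, Finset.mem_coe, Finset.mem_product,
      Finset.mem_Icc, Prod.mk.injEq] at hp hq
    by_contra hne
    have hii : i ≠ i' := fun h => hne (by rw [h])
    wlog hlt : i < m generalizing i i'
    · exact this i' i h.symm hq hp (Ne.symm hne) (Ne.symm hii) (by omega)
    -- Here `j < n`, since `j = n` would force `i = i' = 1`. The word leads to `(1, 1)` and `(m,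
    -- 1)`, of which only the latter is accepting.
    obtain ⟨w, h1, h2, h3, -⟩ := exists_isolating hm hn hmn (i := i) (j := j) (by omega) hlt
      (by omega) (by omega)
    have := run_iff h w
    dsimp only at this
    rw [h1, h2, h3 i' (by simp; omega) hii.symm] at this
    omega

/-- The pair `(m, n)` represents the class accepting all words. -/
theorem complexity_sup (hm : 3 ≤ m) (hn : 3 ≤ n) (hmn : m ≠ n) :
    complexity (pairLanguage m n (fun i j => i = m ∨ j = n) (1, 1)) =
      ((m * n - (m + n - 2) : ℕ) : ℕ∞) := by
  have hnot : (m, n) ∉ Finset.Icc 1 (m - 1) ×ˢ Finset.Icc 1 (n - 1) := by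
    simp only [Finset.mem_product, Finset.mem_Icc]; omega
  rw [complexity_pairLanguage hm hn hmn
    (insert (m, n) (Finset.Icc 1 (m - 1) ×ˢ Finset.Icc 1 (n - 1)))]
  · rw [Finset.card_insert_of_notMem hnot, Finset.card_product, Nat.card_Icc, Nat.card_Icc]
    congr 1
    obtain ⟨m, rfl⟩ : ∃ k, m = k + 1 := ⟨m - 1, by omega⟩
    obtain ⟨n, rfl⟩ : ∃ k, n = k + 1 := ⟨n - 1, by omega⟩
    simp only [Nat.add_sub_cancel, Nat.mul_succ, Nat.succ_mul]
    omega
  · intro ⟨i, j⟩ h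
    simp only [Finset.mem_insert, Finset.mem_product, Finset.mem_Icc, Prod.mk.injEq] at h ⊢
    omega
  · rintro ⟨i, j⟩ hp
    simp only [Finset.mem_product, Finset.mem_Icc] at hp
    by_cases hf : i = m ∨ j = n
    · refine ⟨(m, n), Finset.mem_insert_self _ _, ?_⟩
      ext x
      rcases hf with rfl | rfl <;> simp [mem_pairLanguage, run_final hm, run_final hn]
    · refine ⟨(i, j), Finset.mem_insert_of_mem ?_, rfl⟩
      simp only [Finset.mem_product, Finset.mem_Icc]
      omega
  · rintro ⟨i, j⟩ hp ⟨i', j'⟩ hq h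
    simp only [Finset.coe_insert, Set.mem_insert_iff, Finset.mem_coe, Finset.mem_product,
      Finset.mem_Icc, Prod.mk.injEq] at hp hq
    by_contra hne
    have hij : i' ≠ i ∨ j' ≠ j := by
      by_contra! hc
      exact hne (by rw [hc.1, hc.2])
    -- Of two distinct representatives at most one is `(m, n)`.
    wlog hlt : i < m ∧ j < n generalizing i j i' j'
    · exact this i' j' i j h.symm hq hp (Ne.symm hne) (hij.imp Ne.symm Ne.symm) (by omega)
    obtain ⟨w, h1, h2, h3, h4⟩ := exists_isolating hm hn hmn (i := i) (j := j) (by omega) hlt.1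
      (by omega) hlt.2
    have := run_iff h w
    dsimp only at this
    rw [h1, h2] at this
    rcases hij with hi | hj
    · rw [h3 i' (by simp; omega) hi] at this
      omega
    · rw [h4 j' (by simp; omega) hj] at this
      omega

end Complexity

end RightIdeal


/-! ### The four Boolean operations -/

theorem mainTheorem8 (m n : ℕ) (hm : 3 ≤ m) (hn : 3 ≤ n) (hmn : m ≠ n) :
    RightIdeal.complexity (RightIdeal.witnessABD m hm ⊓ RightIdeal.witnessABD n hn)
        = ((m * n : ℕ) : ℕ∞) ∧
    RightIdeal.complexity (symmDiff (RightIdeal.witnessABD m hm) (RightIdeal.witnessABD n hn))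
        = ((m * n : ℕ) : ℕ∞) ∧
    RightIdeal.complexity (RightIdeal.witnessABD m hm \ RightIdeal.witnessABD n hn)
        = ((m * n - (m - 1) : ℕ) : ℕ∞) ∧
    RightIdeal.complexity (RightIdeal.witnessABD m hm ⊔ RightIdeal.witnessABD n hn)
        = ((m * n - (m + n - 2) : ℕ) : ℕ∞) := by
  refine ⟨?_, ?_, ?_, ?_⟩
  · rw [← RightIdeal.complexity_eq_mul (P := fun i j => i = m ∧ j = n) hm hn hmn
      (fun i hi => by simp [hi]) (fun j hj => by simp [hj])]
    congr 1
    ext x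
    exact and_congr (RightIdeal.mem_witnessABD hm x) (RightIdeal.mem_witnessABD hn x)
  · rw [← RightIdeal.complexity_eq_mul (P := fun i j => (i = m ∧ j ≠ n) ∨ (j = n ∧ i ≠ m)) hm hn hmn
      (fun i hi => by simp [hi]) (fun j hj => by simp [hj])]
    congr 1
    ext x
    exact or_congr
      (and_congr (RightIdeal.mem_witnessABD hm x) (not_congr (RightIdeal.mem_witnessABD hn x)))
      (and_congr (RightIdeal.mem_witnessABD hn x) (not_congr (RightIdeal.mem_witnessABD hm x)))
  · rw [← RightIdeal.complexity_sdiff hm hn hmn]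
    congr 1
    ext x
    exact and_congr (RightIdeal.mem_witnessABD hm x)
      (not_congr (RightIdeal.mem_witnessABD hn x))
  · rw [← RightIdeal.complexity_sup hm hn hmn]
    congr 1
    ext x
    exact or_congr (RightIdeal.mem_witnessABD hm x) (RightIdeal.mem_witnessABD hn x)
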